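/- Let $\mathbb{N}=\{1,2,3,\ldots\}$. For $m,n,r,s,k\in\mathbb{N}$ with $k\mid mnrs$, let $N(m,n,r,s;k)$ denote the number of subgroups of order $k$ of the group $\mathbb{Z}_m\times\mathbb{Z}_n\times\mathbb{Z}_r\times\mathbb{Z}_s$. Then $$N(m,n,r,s;k)=\sum \varphi(x_3)\,\varphi(y_3)\,\varphi(z_3)\,\varphi(t_3)\,F(u,v),$$ where $\varphi$ is Euler's function, $F(u,v)$ is the number of automorphisms of the group $\mathbb{Z}_u\times\mathbb{Z}_v$, and the (finite) sum is over all $$(x_1,\ldots,x_5,y_1,\ldots,y_5,z_1,\ldots,z_5,t_1,\ldots,t_5)\in\mathbb{N}^{20}$$ satisfying the following $11$ conditions: (1) $x_1x_2x_3=m$, (2) $x_3x_4x_5=n$, (3) $y_1y_2y_3=\gcd(x_1,x_4)$, (4) $y_3y_4y_5=x_3\operatorname{lcm}(x_1,x_4)$, (5) $z_1z_2z_3=r$, (6) $z_3z_4z_5=s$, (7) $t_1t_2t_3=\gcd(z_1,z_4)$, (8) $t_3t_4t_5=z_3\operatorname{lcm}(z_1,z_4)$, (9) $\gcd(y_2,y_5)=\gcd(t_2,t_5)=:u$,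 (10) $y_3\operatorname{lcm}(y_2,y_5)=t_3\operatorname{lcm}(t_2,t_5)=:v$, (11) $x_1x_3x_4t_1t_3t_4=k$. -/

import Mathlib

/-- Ordered quintuples of positive integers. -/
structure PosQuintuple where
  c1 : ℕ+
  c2 : ℕ+
  c3 : ℕ+
  c4 : ℕ+
  c5 : ℕ+

/-- The number of subgroups of order `k` of `ℤ/m × ℤ/n × ℤ/r × ℤ/s`. -/
noncomputable def numSubgroupsOfOrder (m n r s k : ℕ) : ℕ :=
  Nat.card {K : AddSubgroup (ZMod m × ZMod n × ZMod r × ZMod s) // Nat.card K = k}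

/-- The number of automorphisms of the group `ℤ/u × ℤ/v`. -/
noncomputable def numAut (u v : ℕ) : ℕ :=
  Nat.card (ZMod u × ZMod v ≃+ ZMod u × ZMod v)

/-- The eleven conditions on the twenty positive integers that index the sum. -/
structure IsIndex (m n r s k : ℕ) (x y z t : PosQuintuple) : Prop where
  cond1 : (x.c1 * x.c2 * x.c3 : ℕ) = m
  cond2 : (x.c3 * x.c4 * x.c5 : ℕ) = n
  cond3 : (y.c1 * y.c2 * y.c3 : ℕ) = Nat.gcd x.c1 x.c4
  cond4 : (y.c3 * y.c4 * y.c5 : ℕ) = x.c3 * Nat.lcm x.c1 x.c4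
  cond5 : (z.c1 * z.c2 * z.c3 : ℕ) = r
  cond6 : (z.c3 * z.c4 * z.c5 : ℕ) = s
  cond7 : (t.c1 * t.c2 * t.c3 : ℕ) = Nat.gcd z.c1 z.c4
  cond8 : (t.c3 * t.c4 * t.c5 : ℕ) = z.c3 * Nat.lcm z.c1 z.c4
  cond9 : Nat.gcd y.c2 y.c5 = Nat.gcd t.c2 t.c5
  cond10 : (y.c3 * Nat.lcm y.c2 y.c5 : ℕ) = t.c3 * Nat.lcm t.c2 t.c5
  cond11 : (x.c1 * x.c3 * x.c4 * t.c1 * t.c3 * t.c4 : ℕ) = k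

/-- The index set of the sum, as a set of elements `(x, y, z, t)` of `(ℕ₊)²⁰`. -/
def indexSet (m n r s k : ℕ) :
    Set (PosQuintuple × PosQuintuple × PosQuintuple × PosQuintuple) :=
  {w | IsIndex m n r s k w.1 w.2.1 w.2.2.1 w.2.2.2}

/-- The summand `φ(x₃) φ(y₃) φ(z₃) φ(t₃) F(u, v)`, where `u = gcd(y₂, y₅)` and
`v = y₃ lcm(y₂, y₅)`. -/
noncomputable def summand (x y z t : PosQuintuple) : ℕ :=
  Nat.totient x.c3 * Nat.totient y.c3 * Nat.totient z.c3 * Nat.totient t.c3 *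
    numAut (Nat.gcd y.c2 y.c5) (y.c3 * Nat.lcm y.c2 y.c5)

/-- A finite abelian group splits off a cyclic factor whose order is the exponent. -/
theorem exists_addEquiv_prod_zmod_exponent (G : Type) [AddCommGroup G] [Finite G] :
    ∃ C : AddSubgroup G, Nonempty (G ≃+ C × ZMod (AddMonoid.exponent G)) := by
  have hex : AddMonoid.ExponentExists G := AddMonoid.ExponentExists.of_finite
  obtain ⟨g, hg⟩ := AddMonoid.exists_addOrderOf_eq_exponent hex
  have hb : 0 < AddMonoid.exponent G := AddMonoid.exponent_pos.2 hex
  have hkill : ∀ x : G, AddMonoid.exponent G • x = 0 := AddMonoid.exponent_nsmul_eq_zero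
  generalize AddMonoid.exponent G = b at *
  let f : ZMod b →+ G := ZMod.lift b ⟨zmultiplesHom G g, by simpa using hkill g⟩
  have hf : Function.Injective f := by
    rw [ZMod.lift_injective]
    intro m hm
    rw [ZMod.intCast_zmod_eq_zero_iff_dvd, ← hg]
    exact addOrderOf_dvd_iff_zsmul_eq_zero.2 (by simpa using hm)
  have hord : addOrderOf (((1 : ℚ) / b : ℚ) : AddCircle (1 : ℚ)) = b :=
    AddCircle.addOrderOf_period_div hb
  let ψ : ZMod b →+ AddCircle (1 : ℚ) :=
    ZMod.lift b ⟨zmultiplesHom _ (((1 : ℚ) / b : ℚ) : AddCircle (1 : ℚ)), by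
      have := addOrderOf_nsmul_eq_zero (((1 : ℚ) / b : ℚ) : AddCircle (1 : ℚ))
      rw [hord] at this
      rw [zmultiplesHom_apply, natCast_zsmul, this]⟩
  have hψ : Function.Injective ψ := by
    rw [ZMod.lift_injective]
    intro m hm
    rw [ZMod.intCast_zmod_eq_zero_iff_dvd, ← hord]
    exact addOrderOf_dvd_iff_zsmul_eq_zero.2 (by simpa using hm)
  obtain ⟨c, hc⟩ := CharacterModule.dual_surjective_of_injective f.toIntLinearMap hf ψ
  let c' : G →+ AddCircle (1 : ℚ) := c
  have hcf : ∀ z, c' (f z) = ψ z := fun z => DFunLike.congr_fun hc z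
  let F : c'.ker × ZMod b →+ G := c'.ker.subtype.coprod f
  refine ⟨c'.ker, ⟨(AddEquiv.ofBijective F ⟨?_, ?_⟩).symm⟩⟩
  · rw [injective_iff_map_eq_zero]
    rintro ⟨⟨k, hk⟩, z⟩ h
    have h' : k + f z = 0 := h
    have hz : z = 0 := by
      apply hψ
      have := congrArg c' h'
      rw [map_add, hcf, AddMonoidHom.mem_ker.1 hk, zero_add, map_zero] at this
      rw [this, map_zero]
    subst hz
    simpa using h'
  · intro x
    have hx : b • c' x = 0 := by rw [← map_nsmul, hkill, map_zero]
    obtain ⟨m, -, hm⟩ := (AddCircle.nsmul_eq_zero_iff hb).1 hx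
    have hψm : ψ (m : ZMod b) = c' x := by
      rw [← hm, AddCircle.natCast_div_mul_eq_nsmul]
      have := ZMod.lift_coe b ⟨zmultiplesHom _ (((1 : ℚ) / b : ℚ) : AddCircle (1 : ℚ)), by
        have := addOrderOf_nsmul_eq_zero (((1 : ℚ) / b : ℚ) : AddCircle (1 : ℚ))
        rw [hord] at this
        rw [zmultiplesHom_apply, natCast_zsmul, this]⟩ (m : ℤ)
      simpa [ψ] using this
    refine ⟨(⟨x - f m, ?_⟩, m), ?_⟩
    · rw [AddMonoidHom.mem_ker, map_sub, hcf, hψm, sub_self]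
    · simp [F]

/-- The `d`-torsion of `G` has at most `d ^ 2` elements, for every positive `d`. -/
def TorsionCardLeSq (G : Type) [AddCommGroup G] : Prop :=
  ∀ d : ℕ, 0 < d → Nat.card (nsmulAddMonoidHom d : G →+ G).ker ≤ d ^ 2

theorem TorsionCardLeSq.addSubgroup {G : Type} [AddCommGroup G] [Finite G]
    (h : TorsionCardLeSq G) (H : AddSubgroup G) : TorsionCardLeSq H := by
  intro d hd
  refine le_trans (Nat.card_le_card_of_injective
    (fun x => (⟨(x.1 : G), ?_⟩ : (nsmulAddMonoidHom d : G →+ G).ker)) ?_) (h d hd)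
  · have := congrArg (Subtype.val) (AddMonoidHom.mem_ker.1 x.2)
    simpa using this
  · intro x y hxy
    have h : (x.1 : G) = y.1 := congrArg (fun w => w.1) hxy
    exact Subtype.ext (Subtype.ext h)

theorem TorsionCardLeSq.quotient {G : Type} [AddCommGroup G] [Finite G]
    (h : TorsionCardLeSq G) (H : AddSubgroup G) : TorsionCardLeSq (G ⧸ H) := by
  intro d hd
  refine le_trans ?_ (h d hd)
  rw [← AddSubgroup.index_range, ← AddSubgroup.index_range]
  have hmap : ((nsmulAddMonoidHom d : G →+ G).range).map (QuotientAddGroup.mk' H) =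
      (nsmulAddMonoidHom d : G ⧸ H →+ G ⧸ H).range := by
    ext x
    constructor
    · rintro ⟨_, ⟨y, rfl⟩, rfl⟩
      exact ⟨QuotientAddGroup.mk' H y, by simp⟩
    · rintro ⟨y, rfl⟩
      obtain ⟨y, rfl⟩ := QuotientAddGroup.mk'_surjective H y
      exact ⟨_, ⟨y, rfl⟩, by simp⟩
  rw [← hmap]
  exact Nat.le_of_dvd (Nat.pos_of_ne_zero AddSubgroup.index_ne_zero_of_finite)
    (AddSubgroup.index_map_dvd _ (QuotientAddGroup.mk'_surjective H))

theorem torsionCardLeSq_prod (A B : Type) [AddCommGroup A] [AddCommGroup B] [Finite A] [Finite B]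
    [IsAddCyclic A] [IsAddCyclic B] : TorsionCardLeSq (A × B) := by
  intro d hd
  have hA : Nat.card (nsmulAddMonoidHom d : A →+ A).ker ≤ d := by
    rw [IsAddCyclic.card_nsmulAddMonoidHom_ker]
    exact Nat.gcd_le_right _ hd
  have hB : Nat.card (nsmulAddMonoidHom d : B →+ B).ker ≤ d := by
    rw [IsAddCyclic.card_nsmulAddMonoidHom_ker]
    exact Nat.gcd_le_right _ hd
  calc Nat.card (nsmulAddMonoidHom d : A × B →+ A × B).ker
      ≤ Nat.card ((nsmulAddMonoidHom d : A →+ A).ker × (nsmulAddMonoidHom d : B →+ B).ker) := by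
        refine Nat.card_le_card_of_injective
          (fun x => (⟨x.1.1, ?_⟩, ⟨x.1.2, ?_⟩)) ?_
        · exact congrArg Prod.fst (AddMonoidHom.mem_ker.1 x.2)
        · exact congrArg Prod.snd (AddMonoidHom.mem_ker.1 x.2)
        · intro x y hxy
          exact Subtype.ext (Prod.ext (congrArg (fun w => w.1.1) hxy)
            (congrArg (fun w => w.2.1) hxy))
    _ ≤ d ^ 2 := by
        rw [Nat.card_prod, sq]
        exact Nat.mul_le_mul hA hB

/-- A finite abelian group with small torsion is determined by its order and its exponent. -/
theorem TorsionCardLeSq.nonempty_addEquiv {G : Type} [AddCommGroup G] [Finite G]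
    (h : TorsionCardLeSq G) {a b : ℕ} (hb : AddMonoid.exponent G = b)
    (hab : Nat.card G = a * b) : Nonempty (G ≃+ ZMod a × ZMod b) := by
  have hb0 : 0 < b := hb ▸ AddMonoid.exponent_pos.2 AddMonoid.ExponentExists.of_finite
  have : NeZero b := ⟨hb0.ne'⟩
  obtain ⟨C, ⟨e⟩⟩ := exists_addEquiv_prod_zmod_exponent G
  rw [hb] at e
  have hkill : ∀ x : C, b • x = 0 := by
    intro x
    apply Subtype.ext
    simpa [hb] using AddMonoid.exponent_nsmul_eq_zero (x : G)
  have hcard : Nat.card C = a := by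
    have := Nat.card_congr e.toEquiv
    rw [hab, Nat.card_prod, Nat.card_zmod] at this
    exact (Nat.eq_of_mul_eq_mul_right hb0 this).symm
  have hC : ∀ d, 0 < d → d ∣ b → Nat.card (nsmulAddMonoidHom d : C →+ C).ker ≤ d := by
    intro d hd hdb
    have h1 := h d hd
    have h2 : Nat.card ((nsmulAddMonoidHom d : C →+ C).ker ×
        (nsmulAddMonoidHom d : ZMod b →+ ZMod b).ker) ≤
        Nat.card (nsmulAddMonoidHom d : G →+ G).ker := by
      refine Nat.card_le_card_of_injective (fun x => ⟨e.symm (x.1.1, x.2.1), ?_⟩) ?_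
      · have hx1 : d • x.1.1 = 0 := x.1.2
        have hx2 : d • x.2.1 = 0 := x.2.2
        change d • e.symm _ = 0
        rw [← map_nsmul, Prod.smul_mk, hx1, hx2]
        exact map_zero _
      · intro x y hxy
        have := e.symm.injective (congrArg Subtype.val hxy)
        exact Prod.ext (Subtype.ext (congrArg Prod.fst this))
          (Subtype.ext (congrArg Prod.snd this))
    rw [Nat.card_prod, IsAddCyclic.card_nsmulAddMonoidHom_ker (ZMod b), Nat.card_zmod,
      Nat.gcd_eq_right hdb] at h2
    exact Nat.le_of_mul_le_mul_right ((h2.trans h1).trans_eq (sq d)) hd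
  have hcyc : IsAddCyclic C := by
    classical
    have := Fintype.ofFinite C
    refine isAddCyclic_of_card_nsmul_eq_zero_le fun d hd => ?_
    have hd' : 0 < d.gcd b := Nat.gcd_pos_of_pos_left _ hd
    refine le_trans ?_ ((hC _ hd' (Nat.gcd_dvd_right _ _)).trans (Nat.gcd_le_left _ hd))
    rw [← Fintype.card_subtype, ← Nat.card_eq_fintype_card]
    refine Nat.card_le_card_of_injective (fun x => ⟨x.1, ?_⟩) ?_
    · change d.gcd b • x.1 = 0
      rw [← addOrderOf_dvd_iff_nsmul_eq_zero]
      exact Nat.dvd_gcd (addOrderOf_dvd_iff_nsmul_eq_zero.2 x.2)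
        (addOrderOf_dvd_iff_nsmul_eq_zero.2 (hkill _))
    · intro x y hxy
      exact Subtype.ext (congrArg (fun w => w.1) hxy)
  exact ⟨e.trans (((zmodAddCyclicAddEquiv hcyc).symm.trans
    (ZMod.ringEquivCongr hcard).toAddEquiv).prodCongr (AddEquiv.refl _))⟩

/-- A subgroup of `A` together with a subgroup of that subgroup. -/
abbrev SubgroupPair (A : Type) [AddCommGroup A] : Type :=
  Σ U : AddSubgroup A, AddSubgroup U

/-- Two pairs of nested subgroups with an isomorphism of their quotients. -/
abbrev GoursatDatum (A B : Type) [AddCommGroup A] [AddCommGroup B] : Type :=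
  Σ P : SubgroupPair A × SubgroupPair B, ((P.1.1 ⧸ P.1.2) ≃+ (P.2.1 ⧸ P.2.2))

namespace GoursatDatum

variable {A B : Type} [AddCommGroup A] [AddCommGroup B]

/-- The subgroup of `A × B` which a Goursat datum describes. -/
def toSubgroup (D : GoursatDatum A B) : AddSubgroup (A × B) :=
  (D.2.toAddMonoidHom.graph.comap
    ((QuotientAddGroup.mk' D.1.1.2).prodMap (QuotientAddGroup.mk' D.1.2.2))).map
    (D.1.1.1.subtype.prodMap D.1.2.1.subtype)

theorem mk_mem_toSubgroup (D : GoursatDatum A B) (a : D.1.1.1) (b : D.1.2.1) :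
    ((a : A), (b : B)) ∈ D.toSubgroup ↔
      D.2 (QuotientAddGroup.mk a) = QuotientAddGroup.mk b := by
  constructor
  · rintro ⟨⟨a', b'⟩, h, h'⟩
    have ha : a' = a := Subtype.ext (congrArg Prod.fst h')
    have hb : b' = b := Subtype.ext (congrArg Prod.snd h')
    subst ha hb
    exact h
  · intro h
    exact ⟨(a, b), h, rfl⟩

theorem mem_of_mem_toSubgroup {D : GoursatDatum A B} {x : A × B} (h : x ∈ D.toSubgroup) :
    x.1 ∈ D.1.1.1 ∧ x.2 ∈ D.1.2.1 := by
  obtain ⟨⟨a, b⟩, -, rfl⟩ := h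
  exact ⟨a.2, b.2⟩

theorem mem_fst_iff (D : GoursatDatum A B) (a : A) :
    a ∈ D.1.1.1 ↔ ∃ b, (a, b) ∈ D.toSubgroup := by
  constructor
  · intro ha
    obtain ⟨b, hb⟩ := QuotientAddGroup.mk_surjective (D.2 (QuotientAddGroup.mk ⟨a, ha⟩))
    exact ⟨b, (D.mk_mem_toSubgroup ⟨a, ha⟩ b).2 hb.symm⟩
  · rintro ⟨b, h⟩
    exact (mem_of_mem_toSubgroup h).1

theorem mem_snd_iff (D : GoursatDatum A B) (b : B) :
    b ∈ D.1.2.1 ↔ ∃ a, (a, b) ∈ D.toSubgroup := by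
  constructor
  · intro hb
    obtain ⟨a, ha⟩ := QuotientAddGroup.mk_surjective (D.2.symm (QuotientAddGroup.mk ⟨b, hb⟩))
    refine ⟨a, (D.mk_mem_toSubgroup a ⟨b, hb⟩).2 ?_⟩
    rw [ha, AddEquiv.apply_symm_apply]
  · rintro ⟨a, h⟩
    exact (mem_of_mem_toSubgroup h).2

theorem mem_fst_inner_iff (D : GoursatDatum A B) (a : D.1.1.1) :
    a ∈ D.1.1.2 ↔ ((a : A), (0 : B)) ∈ D.toSubgroup := by
  have := D.mk_mem_toSubgroup a 0
  rw [ZeroMemClass.coe_zero] at this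
  rw [this, QuotientAddGroup.mk_zero, map_eq_zero_iff _ D.2.injective,
    QuotientAddGroup.eq_zero_iff]

theorem mem_snd_inner_iff (D : GoursatDatum A B) (b : D.1.2.1) :
    b ∈ D.1.2.2 ↔ ((0 : A), (b : B)) ∈ D.toSubgroup := by
  have := D.mk_mem_toSubgroup 0 b
  rw [ZeroMemClass.coe_zero] at this
  rw [this, QuotientAddGroup.mk_zero, map_zero, eq_comm, QuotientAddGroup.eq_zero_iff]

theorem toSubgroup_injective : Function.Injective (toSubgroup : GoursatDatum A B → _) := by
  intro D E h
  have h1 : D.1.1.1 = E.1.1.1 := by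
    ext a; rw [mem_fst_iff, mem_fst_iff, h]
  have h2 : D.1.2.1 = E.1.2.1 := by
    ext a; rw [mem_snd_iff, mem_snd_iff, h]
  obtain ⟨⟨⟨U, V⟩, ⟨U', V'⟩⟩, e⟩ := D
  obtain ⟨⟨⟨W, X⟩, ⟨W', X'⟩⟩, f⟩ := E
  dsimp only at h1 h2
  subst h1 h2
  have h3 : V = X := by
    ext a
    rw [mem_fst_inner_iff ⟨⟨⟨U, V⟩, ⟨U', V'⟩⟩, e⟩ a, h]
    exact (mem_fst_inner_iff ⟨⟨⟨U, X⟩, ⟨U', X'⟩⟩, f⟩ a).symm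
  have h4 : V' = X' := by
    ext a
    rw [mem_snd_inner_iff ⟨⟨⟨U, V⟩, ⟨U', V'⟩⟩, e⟩ a, h]
    exact (mem_snd_inner_iff ⟨⟨⟨U, X⟩, ⟨U', X'⟩⟩, f⟩ a).symm
  subst h3 h4
  have h5 : e = f := by
    ext q
    obtain ⟨a, rfl⟩ := QuotientAddGroup.mk_surjective q
    obtain ⟨b, hb⟩ := QuotientAddGroup.mk_surjective (e (QuotientAddGroup.mk a))
    rw [← hb]
    have := (mk_mem_toSubgroup ⟨⟨⟨U, V⟩, ⟨U', V'⟩⟩, e⟩ a b).2 hb.symm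
    rw [h] at this
    exact ((mk_mem_toSubgroup ⟨⟨⟨U, V⟩, ⟨U', V'⟩⟩, f⟩ a b).1 this).symm
  rw [h5]

theorem toSubgroup_surjective : Function.Surjective (toSubgroup : GoursatDatum A B → _) := by
  intro I
  obtain ⟨G', H', M, N, hM, hN, e, h⟩ := AddSubgroup.goursat (I := I)
  exact ⟨⟨⟨⟨G', M⟩, ⟨H', N⟩⟩, e⟩, h.symm⟩

/-- **Goursat's lemma** as a bijection. -/
noncomputable def equivSubgroup : GoursatDatum A B ≃ AddSubgroup (A × B) :=
  Equiv.ofBijective toSubgroup ⟨toSubgroup_injective, toSubgroup_surjective⟩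

/-- The projection of the subgroup of a Goursat datum to the first factor. -/
def projFst (D : GoursatDatum A B) : D.toSubgroup →+ D.1.1.1 :=
  ((AddMonoidHom.fst A B).comp D.toSubgroup.subtype).codRestrict D.1.1.1
    fun x => (mem_of_mem_toSubgroup x.2).1

theorem card_toSubgroup (D : GoursatDatum A B) :
    Nat.card D.toSubgroup = Nat.card D.1.1.1 * Nat.card D.1.2.2 := by
  have hsurj : Function.Surjective D.projFst := by
    rintro ⟨a, ha⟩
    obtain ⟨b, hb⟩ := (D.mem_fst_iff a).1 ha
    exact ⟨⟨(a, b), hb⟩, rfl⟩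
  have hker : Nat.card D.projFst.ker = Nat.card D.1.2.2 := by
    refine Nat.card_congr (Equiv.ofBijective
      (fun x => (⟨⟨x.1.1.2, (mem_of_mem_toSubgroup x.1.2).2⟩, ?_⟩ : D.1.2.2)) ⟨?_, ?_⟩)
    · have hx : x.1.1.1 = 0 := congrArg Subtype.val (AddMonoidHom.mem_ker.1 x.2)
      rw [mem_snd_inner_iff, ← hx]
      exact x.1.2
    · intro x y hxy
      have hx : x.1.1.1 = 0 := congrArg Subtype.val (AddMonoidHom.mem_ker.1 x.2)
      have hy : y.1.1.1 = 0 := congrArg Subtype.val (AddMonoidHom.mem_ker.1 y.2)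
      refine Subtype.ext (Subtype.ext (Prod.ext (hx.trans hy.symm) ?_))
      simpa [Subtype.ext_iff] using hxy
    · rintro ⟨b, hb⟩
      exact ⟨⟨⟨(0, b), (D.mem_snd_inner_iff b).1 hb⟩, rfl⟩, rfl⟩
  rw [← AddSubgroup.card_mul_index D.projFst.ker, AddSubgroup.index_ker,
    AddMonoidHom.range_eq_top.2 hsurj, AddSubgroup.card_top, hker, mul_comm]

end GoursatDatum

theorem PosQuintuple.eq_of_coe {x y : PosQuintuple} (h₁ : (x.c1 : ℕ) = y.c1)
    (h₂ : (x.c2 : ℕ) = y.c2) (h₃ : (x.c3 : ℕ) = y.c3) (h₄ : (x.c4 : ℕ) = y.c4)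
    (h₅ : (x.c5 : ℕ) = y.c5) : x = y := by
  obtain ⟨a, b, c, d, e⟩ := x
  obtain ⟨a', b', c', d', e'⟩ := y
  obtain rfl := PNat.eq h₁
  obtain rfl := PNat.eq h₂
  obtain rfl := PNat.eq h₃
  obtain rfl := PNat.eq h₄
  obtain rfl := PNat.eq h₅
  rfl

section Cyclic

variable (A B : Type) [AddCommGroup A] [AddCommGroup B] [Finite A] [Finite B]
  [IsAddCyclic A] [IsAddCyclic B]

theorem IsAddCyclic.existsUnique_addSubgroup_card {d : ℕ} (hd : d ∣ Nat.card A) :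
    ∃! U : AddSubgroup A, Nat.card U = d := by
  have hK : Nat.card (nsmulAddMonoidHom d : A →+ A).ker = d := by
    rw [IsAddCyclic.card_nsmulAddMonoidHom_ker, Nat.gcd_eq_right hd]
  refine ⟨_, hK, fun U hU => ?_⟩
  refine AddSubgroup.eq_of_le_of_card_ge (fun x hx => ?_) (by rw [hU, hK])
  have := card_nsmul_eq_zero' (x := (⟨x, hx⟩ : U))
  rw [hU] at this
  exact congrArg Subtype.val this

theorem existsUnique_subgroupPair {x₁ x₂ x₃ : ℕ} (h : x₁ * x₂ * x₃ = Nat.card A) :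
    ∃! P : SubgroupPair A, Nat.card P.2 = x₁ ∧ P.1.index = x₂ ∧ P.2.index = x₃ := by
  have hpos : 0 < x₁ * x₂ * x₃ := h ▸ Nat.card_pos
  have h1 : 0 < x₁ := Nat.pos_of_ne_zero (by rintro rfl; simp at hpos)
  have h2 : 0 < x₂ := Nat.pos_of_ne_zero (by rintro rfl; simp at hpos)
  have h3 : 0 < x₃ := Nat.pos_of_ne_zero (by rintro rfl; simp at hpos)
  obtain ⟨U, hU, hU'⟩ := IsAddCyclic.existsUnique_addSubgroup_card A
    (d := x₁ * x₃) ⟨x₂, by rw [← h]; ring⟩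
  obtain ⟨V, hV, hV'⟩ := IsAddCyclic.existsUnique_addSubgroup_card U
    (d := x₁) ⟨x₃, hU⟩
  refine ⟨⟨U, V⟩, ⟨hV, ?_, ?_⟩, ?_⟩
  · have := U.card_mul_index
    rw [hU, ← h] at this
    refine Nat.eq_of_mul_eq_mul_left (Nat.mul_pos h1 h3) ?_
    rw [this]; ring
  · have := V.card_mul_index
    rw [hU, hV] at this
    exact Nat.eq_of_mul_eq_mul_left h1 this
  · rintro ⟨U₁, V₁⟩ ⟨hc, -, hi⟩
    dsimp only at hc hi
    have hU₁ := V₁.card_mul_index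
    rw [hc, hi] at hU₁
    obtain rfl := hU' U₁ hU₁.symm
    obtain rfl := hV' V₁ hc
    rfl

variable {A B} in
omit [Finite B] in
theorem IsAddCyclic.card_addEquiv (h : Nat.card A = Nat.card B) :
    Nat.card (A ≃+ B) = Nat.totient (Nat.card A) := by
  have e : A ≃+ B := addEquivOfAddCyclicCardEq h
  rw [← Nat.card_congr (Multiplicative.toAdd (α := A)), ← IsCyclic.card_mulAut]
  refine Nat.card_congr ?_
  exact (⟨fun f => f.trans e.symm, fun f => f.trans e, fun f => by ext; simp,
    fun f => by ext; simp⟩ : (A ≃+ B) ≃ (A ≃+ A)).trans AddEquiv.toMultiplicative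

end Cyclic

namespace GoursatDatum

variable {A B : Type} [AddCommGroup A] [AddCommGroup B] [Finite A] [Finite B]

omit [Finite A] [Finite B] in
theorem index_eq (D : GoursatDatum A B) : D.1.1.2.index = D.1.2.2.index :=
  Nat.card_congr D.2.toEquiv

/-- The orders and indices of the four subgroups of a Goursat datum. -/
noncomputable def quintuple (D : GoursatDatum A B) : PosQuintuple where
  c1 := ⟨Nat.card D.1.1.2, Nat.card_pos⟩
  c2 := ⟨D.1.1.1.index, Nat.pos_of_ne_zero AddSubgroup.index_ne_zero_of_finite⟩
  c3 := ⟨D.1.1.2.index, Nat.pos_of_ne_zero AddSubgroup.index_ne_zero_of_finite⟩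
  c4 := ⟨Nat.card D.1.2.2, Nat.card_pos⟩
  c5 := ⟨D.1.2.1.index, Nat.pos_of_ne_zero AddSubgroup.index_ne_zero_of_finite⟩

theorem card_fst (D : GoursatDatum A B) :
    Nat.card D.1.1.1 = D.quintuple.c1 * D.quintuple.c3 :=
  (D.1.1.2.card_mul_index).symm

theorem card_snd (D : GoursatDatum A B) :
    Nat.card D.1.2.1 = D.quintuple.c3 * D.quintuple.c4 := by
  rw [← D.1.2.2.card_mul_index, ← D.index_eq, mul_comm]
  rfl

theorem quintuple_fst (D : GoursatDatum A B) :
    (D.quintuple.c1 * D.quintuple.c2 * D.quintuple.c3 : ℕ) = Nat.card A := by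
  rw [← D.1.1.1.card_mul_index, card_fst, mul_right_comm]
  rfl

theorem quintuple_snd (D : GoursatDatum A B) :
    (D.quintuple.c3 * D.quintuple.c4 * D.quintuple.c5 : ℕ) = Nat.card B := by
  rw [← D.1.2.1.card_mul_index, card_snd]
  rfl

theorem card_toSubgroup_eq (D : GoursatDatum A B) :
    Nat.card D.toSubgroup = D.quintuple.c1 * D.quintuple.c3 * D.quintuple.c4 := by
  rw [card_toSubgroup, card_fst]
  rfl

variable [IsAddCyclic A] [IsAddCyclic B]

theorem card_quintuple_eq (x : PosQuintuple) (h₁ : (x.c1 * x.c2 * x.c3 : ℕ) = Nat.card A)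
    (h₂ : (x.c3 * x.c4 * x.c5 : ℕ) = Nat.card B) :
    Nat.card {D : GoursatDatum A B // D.quintuple = x} = Nat.totient x.c3 := by
  obtain ⟨P, ⟨hP1, hP2, hP3⟩, hP⟩ := existsUnique_subgroupPair A h₁
  obtain ⟨Q, ⟨hQ1, hQ2, hQ3⟩, hQ⟩ := existsUnique_subgroupPair B
    (x₁ := x.c4) (x₂ := x.c5) (x₃ := x.c3) (by rw [← h₂]; ring)
  have hc : Nat.card (P.1 ⧸ P.2) = x.c3 := hP3
  have hc' : Nat.card (Q.1 ⧸ Q.2) = x.c3 := hQ3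
  have hcycP : IsAddCyclic (P.1 ⧸ P.2) :=
    isAddCyclic_of_surjective (QuotientAddGroup.mk' P.2) (QuotientAddGroup.mk'_surjective _)
  have hcycQ : IsAddCyclic (Q.1 ⧸ Q.2) :=
    isAddCyclic_of_surjective (QuotientAddGroup.mk' Q.2) (QuotientAddGroup.mk'_surjective _)
  rw [← hc, ← IsAddCyclic.card_addEquiv (hc.trans hc'.symm)]
  symm
  refine Nat.card_congr (Equiv.ofBijective (fun e => ⟨⟨(P, Q), e⟩, ?_⟩) ⟨?_, ?_⟩)
  · exact PosQuintuple.eq_of_coe hP1 hP2 hP3 hQ1 hQ2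
  · intro e f hef
    simpa using hef
  · rintro ⟨⟨⟨P', Q'⟩, e⟩, rfl⟩
    obtain rfl := hP P' ⟨rfl, rfl, rfl⟩
    obtain rfl := hQ Q' ⟨rfl, rfl, (index_eq ⟨(P', Q'), e⟩).symm⟩
    exact ⟨e, rfl⟩

theorem exponent_toSubgroup (D : GoursatDatum A B) :
    AddMonoid.exponent D.toSubgroup =
      D.quintuple.c3 * Nat.lcm D.quintuple.c1 D.quintuple.c4 := by
  rw [← Nat.lcm_mul_left, mul_comm (D.quintuple.c3 : ℕ) D.quintuple.c1, ← card_fst, ← card_snd,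
    ← IsAddCyclic.exponent_eq_card, ← IsAddCyclic.exponent_eq_card (α := D.1.2.1)]
  refine Nat.dvd_antisymm ?_ (Nat.lcm_dvd ?_ ?_)
  · rw [AddMonoid.exponent_dvd_iff_forall_nsmul_eq_zero]
    rintro ⟨⟨a, b⟩, h⟩
    have h1 := AddMonoid.exponent_dvd_iff_forall_nsmul_eq_zero.1
      (Nat.dvd_lcm_left (AddMonoid.exponent D.1.1.1) (AddMonoid.exponent D.1.2.1))
      ⟨a, (mem_of_mem_toSubgroup h).1⟩
    have h2 := AddMonoid.exponent_dvd_iff_forall_nsmul_eq_zero.1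
      (Nat.dvd_lcm_right (AddMonoid.exponent D.1.1.1) (AddMonoid.exponent D.1.2.1))
      ⟨b, (mem_of_mem_toSubgroup h).2⟩
    exact Subtype.ext (Prod.ext (congrArg Subtype.val h1) (congrArg Subtype.val h2))
  · rw [AddMonoid.exponent_dvd_iff_forall_nsmul_eq_zero]
    rintro ⟨a, ha⟩
    obtain ⟨b, hb⟩ := (D.mem_fst_iff a).1 ha
    have := AddMonoid.exponent_nsmul_eq_zero (⟨(a, b), hb⟩ : D.toSubgroup)
    exact Subtype.ext (congrArg (fun w => w.1.1) this)
  · rw [AddMonoid.exponent_dvd_iff_forall_nsmul_eq_zero]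
    rintro ⟨b, hb⟩
    obtain ⟨a, ha⟩ := (D.mem_snd_iff b).1 hb
    have := AddMonoid.exponent_nsmul_eq_zero (⟨(a, b), ha⟩ : D.toSubgroup)
    exact Subtype.ext (congrArg (fun w => w.1.2) this)

theorem exponent_quotient_toSubgroup (D : GoursatDatum A B) :
    AddMonoid.exponent ((A × B) ⧸ D.toSubgroup) =
      D.quintuple.c3 * Nat.lcm D.quintuple.c2 D.quintuple.c5 := by
  let K : AddSubgroup A := D.1.1.2.map D.1.1.1.subtype
  let L : AddSubgroup B := D.1.2.2.map D.1.2.1.subtype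
  have hKcyc : IsAddCyclic (A ⧸ K) :=
    isAddCyclic_of_surjective (QuotientAddGroup.mk' K) (QuotientAddGroup.mk'_surjective _)
  have hLcyc : IsAddCyclic (B ⧸ L) :=
    isAddCyclic_of_surjective (QuotientAddGroup.mk' L) (QuotientAddGroup.mk'_surjective _)
  have hKcard : Nat.card (A ⧸ K) = D.quintuple.c3 * D.quintuple.c2 :=
    (AddSubgroup.index_map_subtype D.1.1.2)
  have hLcard : Nat.card (B ⧸ L) = D.quintuple.c3 * D.quintuple.c5 := by
    have h := AddSubgroup.index_map_subtype D.1.2.2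
    rw [← D.index_eq] at h
    exact h
  have hK : ∀ a : A, a ∈ K ↔ (a, (0 : B)) ∈ D.toSubgroup := by
    intro a
    constructor
    · rintro ⟨a, ha, rfl⟩
      exact (D.mem_fst_inner_iff a).1 ha
    · intro h
      exact ⟨⟨a, (mem_of_mem_toSubgroup h).1⟩, (D.mem_fst_inner_iff _).2 h, rfl⟩
  have hL : ∀ b : B, b ∈ L ↔ ((0 : A), b) ∈ D.toSubgroup := by
    intro b
    constructor
    · rintro ⟨b, hb, rfl⟩
      exact (D.mem_snd_inner_iff b).1 hb
    · intro h
      exact ⟨⟨b, (mem_of_mem_toSubgroup h).2⟩, (D.mem_snd_inner_iff _).2 h, rfl⟩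
  rw [← Nat.lcm_mul_left, ← hKcard, ← hLcard, ← IsAddCyclic.exponent_eq_card,
    ← IsAddCyclic.exponent_eq_card (α := B ⧸ L)]
  have key : ∀ (G : Type) [AddCommGroup G] (H : AddSubgroup G) (d : ℕ),
      AddMonoid.exponent (G ⧸ H) ∣ d ↔ ∀ g : G, d • g ∈ H := by
    intro G _ H d
    rw [AddMonoid.exponent_dvd_iff_forall_nsmul_eq_zero,
      (QuotientAddGroup.mk_surjective (s := H)).forall]
    refine forall_congr' fun g => ?_
    rw [← QuotientAddGroup.mk_nsmul, QuotientAddGroup.eq_zero_iff]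
  refine Nat.dvd_antisymm ?_ (Nat.lcm_dvd ?_ ?_)
  · rw [key]
    rintro ⟨a, b⟩
    have h1 := (hK _).1 ((key A K _).1 (Nat.dvd_lcm_left _ (AddMonoid.exponent (B ⧸ L))) a)
    have h2 := (hL _).1 ((key B L _).1 (Nat.dvd_lcm_right (AddMonoid.exponent (A ⧸ K)) _) b)
    simpa using add_mem h1 h2
  · rw [key]
    intro a
    rw [hK]
    simpa using (key _ D.toSubgroup _).1 dvd_rfl (a, 0)
  · rw [key]
    intro b
    rw [hL]
    simpa using (key _ D.toSubgroup _).1 dvd_rfl (0, b)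

omit [IsAddCyclic A] [IsAddCyclic B] in
theorem index_toSubgroup (D : GoursatDatum A B) :
    D.toSubgroup.index = D.quintuple.c2 * D.quintuple.c3 * D.quintuple.c5 := by
  have h := D.toSubgroup.card_mul_index
  rw [Nat.card_prod, ← D.quintuple_fst, ← D.quintuple_snd, card_toSubgroup_eq] at h
  refine Nat.eq_of_mul_eq_mul_left
    (Nat.mul_pos (Nat.mul_pos D.quintuple.c1.pos D.quintuple.c3.pos) D.quintuple.c4.pos)
    (h.trans ?_)
  ring

theorem nonempty_toSubgroup_addEquiv (D : GoursatDatum A B) :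
    Nonempty (D.toSubgroup ≃+ ZMod (Nat.gcd D.quintuple.c1 D.quintuple.c4) ×
      ZMod (D.quintuple.c3 * Nat.lcm D.quintuple.c1 D.quintuple.c4)) := by
  refine ((torsionCardLeSq_prod A B).addSubgroup _).nonempty_addEquiv D.exponent_toSubgroup ?_
  rw [card_toSubgroup_eq, mul_left_comm, Nat.gcd_mul_lcm]
  ring

theorem nonempty_quotient_addEquiv (D : GoursatDatum A B) :
    Nonempty ((A × B) ⧸ D.toSubgroup ≃+ ZMod (Nat.gcd D.quintuple.c2 D.quintuple.c5) ×
      ZMod (D.quintuple.c3 * Nat.lcm D.quintuple.c2 D.quintuple.c5)) := by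
  refine ((torsionCardLeSq_prod A B).quotient _).nonempty_addEquiv
    D.exponent_quotient_toSubgroup (D.index_toSubgroup.trans ?_)
  rw [mul_left_comm, Nat.gcd_mul_lcm]
  ring

end GoursatDatum

section Quintuple

variable {G A B : Type} [AddCommGroup G] [AddCommGroup A] [AddCommGroup B] [Finite A] [Finite B]

/-- The Goursat datum of a subgroup of `G`, where `G` is isomorphic to `A × B`. -/
noncomputable def goursatDatum (e : G ≃+ A × B) (S : AddSubgroup G) : GoursatDatum A B :=
  GoursatDatum.equivSubgroup.symm (e.mapAddSubgroup S)

omit [Finite A] [Finite B] in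
theorem toSubgroup_goursatDatum (e : G ≃+ A × B) (S : AddSubgroup G) :
    (goursatDatum e S).toSubgroup = S.map e.toAddMonoidHom :=
  GoursatDatum.equivSubgroup.apply_symm_apply _

/-- The quintuple of a subgroup of `G`, where `G` is isomorphic to `A × B`. -/
noncomputable def subgroupQuintuple (e : G ≃+ A × B) (S : AddSubgroup G) : PosQuintuple :=
  (goursatDatum e S).quintuple

theorem card_eq_subgroupQuintuple (e : G ≃+ A × B) (S : AddSubgroup G) :
    Nat.card S = (subgroupQuintuple e S).c1 * (subgroupQuintuple e S).c3 *
      (subgroupQuintuple e S).c4 := by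
  rw [subgroupQuintuple, ← GoursatDatum.card_toSubgroup_eq, toSubgroup_goursatDatum]
  exact Nat.card_congr (e.addSubgroupMap S).toEquiv

variable [IsAddCyclic A] [IsAddCyclic B]

theorem nonempty_addEquiv_subgroupQuintuple (e : G ≃+ A × B) (S : AddSubgroup G) :
    Nonempty (S ≃+
      ZMod (Nat.gcd (subgroupQuintuple e S).c1 (subgroupQuintuple e S).c4) ×
      ZMod ((subgroupQuintuple e S).c3 *
        Nat.lcm (subgroupQuintuple e S).c1 (subgroupQuintuple e S).c4)) := by
  obtain ⟨f⟩ := (goursatDatum e S).nonempty_toSubgroup_addEquiv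
  rw [toSubgroup_goursatDatum] at f
  exact ⟨(e.addSubgroupMap S).trans f⟩

theorem nonempty_quotient_addEquiv_subgroupQuintuple (e : G ≃+ A × B) (S : AddSubgroup G) :
    Nonempty (G ⧸ S ≃+
      ZMod (Nat.gcd (subgroupQuintuple e S).c2 (subgroupQuintuple e S).c5) ×
      ZMod ((subgroupQuintuple e S).c3 *
        Nat.lcm (subgroupQuintuple e S).c2 (subgroupQuintuple e S).c5)) := by
  obtain ⟨f⟩ := (goursatDatum e S).nonempty_quotient_addEquiv
  exact ⟨(QuotientAddGroup.congr _ _ e (toSubgroup_goursatDatum e S).symm).trans f⟩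

theorem card_subgroupQuintuple_eq (e : G ≃+ A × B) (x : PosQuintuple)
    (h₁ : (x.c1 * x.c2 * x.c3 : ℕ) = Nat.card A)
    (h₂ : (x.c3 * x.c4 * x.c5 : ℕ) = Nat.card B) :
    Nat.card {S : AddSubgroup G // subgroupQuintuple e S = x} = Nat.totient x.c3 := by
  rw [← GoursatDatum.card_quintuple_eq (A := A) (B := B) x h₁ h₂]
  exact Nat.card_congr (Equiv.subtypeEquiv
    (e.mapAddSubgroup.toEquiv.trans GoursatDatum.equivSubgroup.symm) fun S => Iff.rfl)

end Quintuple

instance PNat.neZero_gcd (a b : ℕ+) : NeZero (Nat.gcd a b) :=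
  ⟨(Nat.gcd_pos_of_pos_left _ a.pos).ne'⟩

instance PNat.neZero_mul_lcm (a b c : ℕ+) : NeZero ((c : ℕ) * Nat.lcm a b) :=
  ⟨(Nat.mul_pos c.pos (Nat.lcm_pos a.pos b.pos)).ne'⟩

section Pair

variable {m n : ℕ} [NeZero m] [NeZero n]

/-- The quintuple of the outer subgroup of a pair. -/
noncomputable def outerQuintuple (U : AddSubgroup (ZMod m × ZMod n)) : PosQuintuple :=
  subgroupQuintuple (AddEquiv.refl (ZMod m × ZMod n)) U

theorem nonempty_outerAddEquiv (U : AddSubgroup (ZMod m × ZMod n)) :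
    Nonempty (U ≃+ ZMod (Nat.gcd (outerQuintuple U).c1 (outerQuintuple U).c4) ×
      ZMod ((outerQuintuple U).c3 * Nat.lcm (outerQuintuple U).c1 (outerQuintuple U).c4)) :=
  nonempty_addEquiv_subgroupQuintuple (AddEquiv.refl (ZMod m × ZMod n)) U

/-- A decomposition of a subgroup of `ℤ/m × ℤ/n` as a product of two cyclic groups. -/
noncomputable def outerAddEquiv (U : AddSubgroup (ZMod m × ZMod n)) :
    U ≃+ ZMod (Nat.gcd (outerQuintuple U).c1 (outerQuintuple U).c4) ×
      ZMod ((outerQuintuple U).c3 * Nat.lcm (outerQuintuple U).c1 (outerQuintuple U).c4) :=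
  (nonempty_outerAddEquiv U).some

/-- The quintuple of the inner subgroup of a pair. -/
noncomputable def innerQuintuple (P : SubgroupPair (ZMod m × ZMod n)) : PosQuintuple :=
  subgroupQuintuple (outerAddEquiv P.1) P.2

/-- The quintuples of both subgroups of a pair. -/
noncomputable def pairQuintuples (P : SubgroupPair (ZMod m × ZMod n)) :
    PosQuintuple × PosQuintuple :=
  (outerQuintuple P.1, innerQuintuple P)

/-- The conditions on the quintuples of a pair of nested subgroups of `ℤ/m × ℤ/n`. -/
structure IsPairIndex (m n : ℕ) (x y : PosQuintuple) : Prop where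
  outer_fst : (x.c1 * x.c2 * x.c3 : ℕ) = m
  outer_snd : (x.c3 * x.c4 * x.c5 : ℕ) = n
  inner_fst : (y.c1 * y.c2 * y.c3 : ℕ) = Nat.gcd x.c1 x.c4
  inner_snd : (y.c3 * y.c4 * y.c5 : ℕ) = x.c3 * Nat.lcm x.c1 x.c4

theorem isPairIndex_pairQuintuples (P : SubgroupPair (ZMod m × ZMod n)) :
    IsPairIndex m n (pairQuintuples P).1 (pairQuintuples P).2 where
  outer_fst := (GoursatDatum.quintuple_fst _).trans (Nat.card_zmod m)
  outer_snd := (GoursatDatum.quintuple_snd _).trans (Nat.card_zmod n)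
  inner_fst := (GoursatDatum.quintuple_fst _).trans (Nat.card_zmod _)
  inner_snd := (GoursatDatum.quintuple_snd _).trans (Nat.card_zmod _)

theorem card_pairQuintuples_eq {x y : PosQuintuple} (h : IsPairIndex m n x y) :
    Nat.card {P : SubgroupPair (ZMod m × ZMod n) // pairQuintuples P = (x, y)} =
      Nat.totient x.c3 * Nat.totient y.c3 := by
  have e : {P : SubgroupPair (ZMod m × ZMod n) // pairQuintuples P = (x, y)} ≃
      Σ U : {U : AddSubgroup (ZMod m × ZMod n) // outerQuintuple U = x},
        {V : AddSubgroup U.1 // subgroupQuintuple (outerAddEquiv U.1) V = y} :=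
    { toFun := fun P => ⟨⟨P.1.1, congrArg Prod.fst P.2⟩, ⟨P.1.2, congrArg Prod.snd P.2⟩⟩
      invFun := fun W => ⟨⟨W.1.1, W.2.1⟩, Prod.ext W.1.2 W.2.2⟩
      left_inv := fun _ => rfl
      right_inv := fun _ => rfl }
  have := Fintype.ofFinite {U : AddSubgroup (ZMod m × ZMod n) // outerQuintuple U = x}
  rw [Nat.card_congr e, Nat.card_sigma, Finset.sum_congr rfl (g := fun _ => Nat.totient y.c3)]
  · rw [Finset.sum_const, Finset.card_univ, ← Nat.card_eq_fintype_card, smul_eq_mul]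
    congr 1
    exact card_subgroupQuintuple_eq _ x (h.outer_fst.trans (Nat.card_zmod m).symm)
      (h.outer_snd.trans (Nat.card_zmod n).symm)
  · rintro ⟨U, rfl⟩ -
    exact card_subgroupQuintuple_eq _ y (h.inner_fst.trans (Nat.card_zmod _).symm)
      (h.inner_snd.trans (Nat.card_zmod _).symm)

end Pair

theorem exponent_zmod_prod_zmod {u v : ℕ} (h : u ∣ v) :
    AddMonoid.exponent (ZMod u × ZMod v) = v := by
  rw [AddMonoid.exponent_prod, ZMod.exponent, ZMod.exponent]
  exact Nat.lcm_eq_right h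

open Classical in
/-- The number of isomorphisms between two products of two cyclic groups in standard form. -/
theorem card_addEquiv_zmod_prod_zmod {u v u' v' : ℕ} [NeZero v] [NeZero v']
    (h : u ∣ v) (h' : u' ∣ v') :
    Nat.card (ZMod u × ZMod v ≃+ ZMod u' × ZMod v') =
      if u = u' ∧ v = v' then numAut u v else 0 := by
  split_ifs with huv
  · obtain ⟨rfl, rfl⟩ := huv
    rfl
  · have : IsEmpty (ZMod u × ZMod v ≃+ ZMod u' × ZMod v') := by
      refine ⟨fun e => huv ?_⟩
      have hv : v = v' := by
        rw [← exponent_zmod_prod_zmod h, ← exponent_zmod_prod_zmod h']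
        exact AddMonoid.exponent_eq_of_addEquiv e
      subst hv
      have hc := Nat.card_congr e.toEquiv
      rw [Nat.card_prod, Nat.card_prod, Nat.card_zmod, Nat.card_zmod, Nat.card_zmod] at hc
      exact ⟨Nat.eq_of_mul_eq_mul_right (Nat.pos_of_ne_zero (NeZero.ne v)) hc, rfl⟩
    exact Nat.card_of_isEmpty

theorem sum_comp_eq_finsum {α β : Type} [Fintype α] (q : α → β) (f : β → ℕ) :
    ∑ a, f (q a) = ∑ᶠ b, Nat.card {a // q a = b} * f b := by
  classical
  rw [finsum_eq_sum_of_support_subset (s := Finset.univ.image q), Finset.sum_comp f q]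
  · refine Finset.sum_congr rfl fun b _ => ?_
    rw [Nat.card_eq_fintype_card, Fintype.card_subtype, smul_eq_mul]
  · intro b hb
    have : Nat.card {a // q a = b} ≠ 0 := fun h => hb (by simp only [h, zero_mul])
    obtain ⟨⟨a, rfl⟩⟩ := (Nat.card_ne_zero.1 this).1
    simp

section Pair

variable {m n : ℕ} [NeZero m] [NeZero n]

theorem card_outer (P : SubgroupPair (ZMod m × ZMod n)) :
    Nat.card P.1 = (pairQuintuples P).1.c1 * (pairQuintuples P).1.c3 * (pairQuintuples P).1.c4 :=
  card_eq_subgroupQuintuple (AddEquiv.refl (ZMod m × ZMod n)) P.1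

theorem card_inner (P : SubgroupPair (ZMod m × ZMod n)) :
    Nat.card P.2 = (pairQuintuples P).2.c1 * (pairQuintuples P).2.c3 * (pairQuintuples P).2.c4 :=
  card_eq_subgroupQuintuple (outerAddEquiv P.1) P.2

theorem nonempty_pair_quotient_addEquiv (P : SubgroupPair (ZMod m × ZMod n)) :
    Nonempty ((P.1 ⧸ P.2) ≃+
      ZMod (Nat.gcd (pairQuintuples P).2.c2 (pairQuintuples P).2.c5) ×
      ZMod ((pairQuintuples P).2.c3 *
        Nat.lcm (pairQuintuples P).2.c2 (pairQuintuples P).2.c5)) :=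
  nonempty_quotient_addEquiv_subgroupQuintuple (outerAddEquiv P.1) P.2

theorem gcd_dvd_mul_lcm (a b c : ℕ) : Nat.gcd a b ∣ c * Nat.lcm a b :=
  (Nat.gcd_dvd_left a b).trans ((Nat.dvd_lcm_left a b).mul_left c)

open Classical in
theorem card_pair_addEquiv {r s : ℕ} [NeZero r] [NeZero s] (P : SubgroupPair (ZMod m × ZMod n))
    (Q : SubgroupPair (ZMod r × ZMod s)) :
    Nat.card ((P.1 ⧸ P.2) ≃+ (Q.1 ⧸ Q.2)) =
      if Nat.gcd (pairQuintuples P).2.c2 (pairQuintuples P).2.c5 =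
          Nat.gcd (pairQuintuples Q).2.c2 (pairQuintuples Q).2.c5 ∧
        ((pairQuintuples P).2.c3 * Nat.lcm (pairQuintuples P).2.c2 (pairQuintuples P).2.c5 : ℕ) =
          (pairQuintuples Q).2.c3 * Nat.lcm (pairQuintuples Q).2.c2 (pairQuintuples Q).2.c5
      then numAut (Nat.gcd (pairQuintuples P).2.c2 (pairQuintuples P).2.c5)
        ((pairQuintuples P).2.c3 * Nat.lcm (pairQuintuples P).2.c2 (pairQuintuples P).2.c5)
      else 0 := by
  obtain ⟨e⟩ := nonempty_pair_quotient_addEquiv P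
  obtain ⟨f⟩ := nonempty_pair_quotient_addEquiv Q
  rw [← card_addEquiv_zmod_prod_zmod (gcd_dvd_mul_lcm _ _ _) (gcd_dvd_mul_lcm _ _ _)]
  exact Nat.card_congr
    { toFun := fun g => (e.symm.trans g).trans f
      invFun := fun g => (e.trans g).trans f.symm
      left_inv := fun g => by ext; simp
      right_inv := fun g => AddEquiv.ext fun x => by simp }

end Pair

theorem card_addSubgroup_card_eq_of_addEquiv {G H : Type} [AddCommGroup G] [AddCommGroup H]
    (e : G ≃+ H) (k : ℕ) :
    Nat.card {K : AddSubgroup G // Nat.card K = k} =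
      Nat.card {K : AddSubgroup H // Nat.card K = k} :=
  Nat.card_congr (Equiv.subtypeEquiv e.mapAddSubgroup.toEquiv fun K => by
    rw [Nat.card_congr (e.addSubgroupMap K).toEquiv]
    rfl)

open Classical in
theorem card_addSubgroup_prod_card_eq (A B : Type) [AddCommGroup A] [AddCommGroup B] [Finite A]
    [Finite B] [Fintype (SubgroupPair A × SubgroupPair B)] (k : ℕ) :
    Nat.card {K : AddSubgroup (A × B) // Nat.card K = k} =
      ∑ P : SubgroupPair A × SubgroupPair B, if Nat.card P.1.1 * Nat.card P.2.2 = k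
        then Nat.card ((P.1.1 ⧸ P.1.2) ≃+ (P.2.1 ⧸ P.2.2)) else 0 := by
  have e : {K : AddSubgroup (A × B) // Nat.card K = k} ≃
      {D : GoursatDatum A B // Nat.card D.1.1.1 * Nat.card D.1.2.2 = k} :=
    (Equiv.subtypeEquiv GoursatDatum.equivSubgroup fun D => by
      rw [← D.card_toSubgroup]; rfl).symm
  rw [Nat.card_congr (e.trans (Equiv.subtypeSigmaEquiv _
    fun P : SubgroupPair A × SubgroupPair B => Nat.card P.1.1 * Nat.card P.2.2 = k)),
    Nat.card_sigma, ← Finset.sum_filter]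
  exact (Finset.sum_subtype _ (by simp)
    (fun P : SubgroupPair A × SubgroupPair B =>
      Nat.card ((P.1.1 ⧸ P.1.2) ≃+ (P.2.1 ⧸ P.2.2)))).symm

section Index

variable {m n r s : ℕ} [NeZero m] [NeZero n] [NeZero r] [NeZero s]

/-- The four quintuples of two pairs of nested subgroups. -/
noncomputable def allQuintuples
    (P : SubgroupPair (ZMod m × ZMod n) × SubgroupPair (ZMod r × ZMod s)) :
    PosQuintuple × PosQuintuple × PosQuintuple × PosQuintuple :=
  ((pairQuintuples P.1).1, (pairQuintuples P.1).2, (pairQuintuples P.2).1, (pairQuintuples P.2).2)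

theorem card_allQuintuples_eq {x y z t : PosQuintuple} (h : IsPairIndex m n x y)
    (h' : IsPairIndex r s z t) :
    Nat.card {P : SubgroupPair (ZMod m × ZMod n) × SubgroupPair (ZMod r × ZMod s) //
      allQuintuples P = (x, y, z, t)} =
      Nat.totient x.c3 * Nat.totient y.c3 * Nat.totient z.c3 * Nat.totient t.c3 := by
  rw [mul_assoc _ (Nat.totient z.c3), ← card_pairQuintuples_eq h, ← card_pairQuintuples_eq h',
    ← Nat.card_prod]
  refine Nat.card_congr ((Equiv.subtypeEquivRight fun P => ?_).trans
    (Equiv.subtypeProdEquivProd (p := fun P => pairQuintuples P = (x, y))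
      (q := fun P => pairQuintuples P = (z, t))))
  simp only [allQuintuples, Prod.ext_iff]
  tauto

theorem indexSet_subset_range (k : ℕ) :
    indexSet m n r s k ⊆ Set.range (allQuintuples (m := m) (n := n) (r := r) (s := s)) := by
  rintro ⟨x, y, z, t⟩ h
  have hc := card_allQuintuples_eq (m := m) (n := n) (r := r) (s := s)
    ⟨h.cond1, h.cond2, h.cond3, h.cond4⟩ ⟨h.cond5, h.cond6, h.cond7, h.cond8⟩
  have hpos : Nat.totient x.c3 * Nat.totient y.c3 * Nat.totient z.c3 * Nat.totient t.c3 ≠ 0 := by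
    have := fun a : ℕ+ => (Nat.totient_pos.2 a.pos).ne'
    simp [this]
  rw [← hc] at hpos
  obtain ⟨⟨P, hP⟩⟩ := (Nat.card_ne_zero.1 hpos).1
  exact ⟨P, hP⟩

open Classical in
/-- The contribution of two pairs of nested subgroups with given quintuples. -/
noncomputable def contribution (k : ℕ)
    (w : PosQuintuple × PosQuintuple × PosQuintuple × PosQuintuple) : ℕ :=
  if (w.1.c1 * w.1.c3 * w.1.c4 * w.2.2.2.c1 * w.2.2.2.c3 * w.2.2.2.c4 : ℕ) = k then
    if Nat.gcd w.2.1.c2 w.2.1.c5 = Nat.gcd w.2.2.2.c2 w.2.2.2.c5 ∧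
      (w.2.1.c3 * Nat.lcm w.2.1.c2 w.2.1.c5 : ℕ) = w.2.2.2.c3 * Nat.lcm w.2.2.2.c2 w.2.2.2.c5
    then numAut (Nat.gcd w.2.1.c2 w.2.1.c5) (w.2.1.c3 * Nat.lcm w.2.1.c2 w.2.1.c5) else 0
  else 0

theorem card_mul_contribution (k : ℕ)
    (w : PosQuintuple × PosQuintuple × PosQuintuple × PosQuintuple) :
    Nat.card {P : SubgroupPair (ZMod m × ZMod n) × SubgroupPair (ZMod r × ZMod s) //
      allQuintuples P = w} * contribution k w =
      (indexSet m n r s k).indicator (fun w => summand w.1 w.2.1 w.2.2.1 w.2.2.2) w := by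
  classical
  by_cases hw : w ∈ indexSet m n r s k
  · rw [Set.indicator_of_mem hw]
    obtain ⟨x, y, z, t⟩ := w
    rw [card_allQuintuples_eq ⟨hw.cond1, hw.cond2, hw.cond3, hw.cond4⟩
      ⟨hw.cond5, hw.cond6, hw.cond7, hw.cond8⟩, contribution, if_pos hw.cond11,
      if_pos ⟨hw.cond9, hw.cond10⟩]
    rfl
  · rw [Set.indicator_of_notMem hw, mul_eq_zero]
    by_contra! h
    obtain ⟨⟨P, rfl⟩⟩ := (Nat.card_ne_zero.1 h.1).1
    have h2 := h.2
    rw [contribution] at h2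
    split_ifs at h2 with hk he
    · have h₁ := isPairIndex_pairQuintuples P.1
      have h₂ := isPairIndex_pairQuintuples P.2
      exact hw ⟨h₁.1, h₁.2, h₁.3, h₁.4, h₂.1, h₂.2, h₂.3, h₂.4, he.1, he.2, hk⟩
    · exact h2 rfl
    · exact h2 rfl

end Index

/-- The sum is finite, and its value is the number of subgroups of order `k`. -/
theorem mainTheorem6 (m n r s k : ℕ) (hm : 0 < m) (hn : 0 < n) (hr : 0 < r) (hs : 0 < s)
    (hk : k ∣ m * n * r * s) :
    (indexSet m n r s k).Finite ∧
      numSubgroupsOfOrder m n r s k =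
        ∑ᶠ w ∈ indexSet m n r s k, summand w.1 w.2.1 w.2.2.1 w.2.2.2 := by
  classical
  have : NeZero m := ⟨hm.ne'⟩
  have : NeZero n := ⟨hn.ne'⟩
  have : NeZero r := ⟨hr.ne'⟩
  have : NeZero s := ⟨hs.ne'⟩
  refine ⟨(Set.finite_range _).subset (indexSet_subset_range k), ?_⟩
  have := Fintype.ofFinite (SubgroupPair (ZMod m × ZMod n) × SubgroupPair (ZMod r × ZMod s))
  rw [numSubgroupsOfOrder, card_addSubgroup_card_eq_of_addEquiv AddEquiv.prodAssoc.symm,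
    card_addSubgroup_prod_card_eq, finsum_mem_def]
  simp only [← card_mul_contribution]
  rw [← sum_comp_eq_finsum]
  refine Finset.sum_congr rfl fun P _ => ?_
  rw [card_pair_addEquiv, card_outer, card_inner, contribution]
  simp only [← mul_assoc]
  rfl
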